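/- Let $d\in\{2,3\}$ and let $\Omega\subset\mathbb{R}^d$ be a bounded, connected and simply connected domain with $C^\infty$ boundary. Let $\rho\in C^\infty(\overline\Omega)$ be a density with $\rho\ge K$ for some constant $K>0$, and let $c=(c^{ijk\ell})\in C^\infty(\overline\Omega)$ be a stiffness tensor field with $c^{ijk\ell}=c^{jik\ell}=c^{k\ell ij}$ and $c^{ijk\ell}A_{ij}A_{k\ell}\ge\delta\,A_{ij}A_{ij}$ for some $\delta>0$ and all symmetric matrices $A$. Write $g_E$ for the Euclidean metric. For $T>0$ let $\Lambda_{(\rho,c)}$ be the Dirichlet-to-Neumann map on $(0,T)\times\partial\Omega$, which sends $f\in C^2([0,T];H^{1/2}(\partial\Omega;\mathbb{R}^d))$ with $f(0)=\partial_tf(0)=0$ to the traction $(\nu_j c_{ijk\ell}\,\partial_{x_k}u_\ell)_i\in L^2(0,T;H^{-1/2}(\partial\Omega;\mathbb{R}^d))$ of the weak solution $u$ of $$\rho\,\partial_t^2u_i=\partial_{x_j}(c_{ijk\ell}\,\partial_{x_k}u_\ell)\ \text{in }(0,T)\times\Omega,\qquad u=f\ \text{on }(0,T)\times\partial\Omega,\qquad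 u(0)=\partial_tu(0)=0.$$ Let $\phi:\overline\Omega\to\overline\Omega$ be a $C^\infty$ diffeomorphism with $\phi|_{\partial\Omega}=\mathrm{id}$ and let $\mu\in C^\infty(\overline\Omega)$ be a nowhere vanishing real function with $\mu|_{\partial\Omega}=1$. They act on triplets $(\rho,c,g)$ of a density, a stiffness tensor field and a metric by the gauge transformation $$(\rho,c,g)\longmapsto\bigl(\mu^{\frac{d}{2+d}}\phi_*\rho,\ \mu\,\phi_*c,\ \mu^{-\frac{2}{2+d}}\phi_*g\bigr),$$ where $\phi_*$ is the usual pushforward of functions, of contravariant tensors of rank 4 and of covariant tensors of rank 2, respectively. Then the gauge freedoms of the Euclidean Dirichlet-to-Neumann map $\Lambda_{(\rho,c)}$ by a diffeomorphism $\phi$ or a function $\mu$ are eliminated, in the following sense. 1. If the gauge transformation turns the Euclidean triplet $(\rho,c,g_E)$ into a Euclidean triplet again, that is, into $(\rho',c',g_E)$ for some $\rho'$ and $c'$, then $\phi=\mathrm{id}$, $\mu=1$, $\rho'=\rho$ and $c'=c$ on $\overline\Omega$. 2. For every $T>0$, the pair $(\phi,\mu)$ is a gauge freedom of the Euclidean Dirichlet-to-Neumann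 map, that is, the gauge transformation turns $(\rho,c,g_E)$ into some $(\rho',c',g_E)$ with $\Lambda_{(\rho',c')}=\Lambda_{(\rho,c)}$, if and only if $\phi=\mathrm{id}$ and $\mu=1$ on $\overline\Omega$. -/

import Mathlib

open Set MeasureTheory Topology
open scoped ContDiff InnerProductSpace

noncomputable section

namespace ElasticGauge

/-- `d`-dimensional Euclidean space. -/
abbrev E (d : ℕ) : Type := EuclideanSpace ℝ (Fin d)

/-- The `j`-th standard basis vector. -/
abbrev e {d : ℕ} (j : Fin d) : E d := EuclideanSpace.single j (1 : ℝ)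

/-! ### Domains, material parameters and metrics -/

/-- An open set with smooth boundary: near every boundary point it is a sublevel set of a smooth
local defining function with non-vanishing differential. -/
def IsSmoothDomain {d : ℕ} (Ω : Set (E d)) : Prop :=
  IsOpen Ω ∧ ∀ x ∈ frontier Ω, ∃ r : E d → ℝ, ContDiff ℝ ∞ r ∧ fderiv ℝ r x ≠ 0 ∧
    ∃ U ∈ 𝓝 x, ∀ y ∈ U, (y ∈ Ω ↔ r y < 0)

/-- A field of rank 4 tensors, in Euclidean coordinates. -/
abbrev Tensor4Field (d : ℕ) : Type := E d → Fin d → Fin d → Fin d → Fin d → ℝ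

/-- A field of rank 2 covariant tensors, in Euclidean coordinates. -/
abbrev MetricField (d : ℕ) : Type := E d → Matrix (Fin d) (Fin d) ℝ

/-- The Euclidean metric `g_E`. -/
def euclideanMetric (d : ℕ) : MetricField d := fun _ => 1

/-- A density of mass on `closure Ω`: smooth up to the boundary and bounded below by a positive
constant. -/
def IsDensity {d : ℕ} (Ω : Set (E d)) (ρ : E d → ℝ) : Prop :=
  ContDiffOn ℝ ∞ ρ (closure Ω) ∧ ∃ K > 0, ∀ x ∈ closure Ω, K ≤ ρ x

/-- A stiffness tensor field on `closure Ω` with respect to the metric `g`: smooth up to the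
boundary, with the minor and major symmetries
`c^{ijkl} = c^{jikl} = c^{klij}`, and positive: `c^{ijkl} A_ij A_kl ≥ δ g^{jk} g^{il} A_ij A_kl` for
all symmetric `A`. -/
structure IsStiffnessTensor {d : ℕ} (Ω : Set (E d)) (g : MetricField d) (c : Tensor4Field d) :
    Prop where
  smooth : ∀ i j k l, ContDiffOn ℝ ∞ (fun x => c x i j k l) (closure Ω)
  minor_symm : ∀ x ∈ closure Ω, ∀ i j k l, c x i j k l = c x j i k l
  major_symm : ∀ x ∈ closure Ω, ∀ i j k l, c x i j k l = c x k l i j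
  pos : ∃ δ > 0, ∀ x ∈ closure Ω, ∀ A : Matrix (Fin d) (Fin d) ℝ, A.IsSymm →
    δ * ∑ i, ∑ j, ∑ k, ∑ l, (g x)⁻¹ j k * (g x)⁻¹ i l * A i j * A k l
      ≤ ∑ i, ∑ j, ∑ k, ∑ l, c x i j k l * A i j * A k l

/-- A triplet `(ρ, c, g)` of a density, a stiffness tensor field and a metric. -/
structure Triplet (d : ℕ) where
  ρ : E d → ℝ
  c : Tensor4Field d
  g : MetricField d

/-- Two triplets are equal as triplets of fields on the set `M`. -/
def Triplet.EqOn {d : ℕ} (p q : Triplet d) (M : Set (E d)) : Prop :=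
  Set.EqOn p.ρ q.ρ M ∧ Set.EqOn p.c q.c M ∧ Set.EqOn p.g q.g M

/-! ### Gauge transformations -/

/-- A `C^∞` diffeomorphism `closure Ω → closure Ω` (smooth up to the boundary, together with its
inverse) that fixes the boundary pointwise. Only the values on `closure Ω` matter. -/
structure BoundaryFixingDiffeo {d : ℕ} (Ω : Set (E d)) where
  toFun : E d → E d
  invFun : E d → E d
  mapsTo : MapsTo toFun (closure Ω) (closure Ω)
  mapsTo_inv : MapsTo invFun (closure Ω) (closure Ω)
  left_inv : LeftInvOn invFun toFun (closure Ω)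
  right_inv : RightInvOn invFun toFun (closure Ω)
  smooth : ContDiffOn ℝ ∞ toFun (closure Ω)
  smooth_inv : ContDiffOn ℝ ∞ invFun (closure Ω)
  fixes : ∀ x ∈ frontier Ω, toFun x = x

/-- A smooth, nowhere vanishing function on `closure Ω` which is equal to `1` on the boundary. -/
def IsGaugeFunction {d : ℕ} (Ω : Set (E d)) (μ : E d → ℝ) : Prop :=
  ContDiffOn ℝ ∞ μ (closure Ω) ∧ (∀ x ∈ closure Ω, μ x ≠ 0) ∧ ∀ x ∈ frontier Ω, μ x = 1

/-- The Jacobian matrix `(∂_j f^i)(x)` of a map `f` of `closure Ω`; at boundary points the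
derivative is the one-sided derivative from `closure Ω`. -/
def jacobian {d : ℕ} (Ω : Set (E d)) (f : E d → E d) (x : E d) : Matrix (Fin d) (Fin d) ℝ :=
  fun i j => (fderivWithin ℝ f (closure Ω) x (e j)) i

/-- The usual pushforward `φ_* ρ` of a scalar function. -/
def pushDensity {d : ℕ} {Ω : Set (E d)} (φ : BoundaryFixingDiffeo Ω) (ρ : E d → ℝ) : E d → ℝ :=
  fun y => ρ (φ.invFun y)

/-- The usual pushforward `φ_* c` of a contravariant rank 4 tensor field. -/
def pushStiffness {d : ℕ} {Ω : Set (E d)} (φ : BoundaryFixingDiffeo Ω) (c : Tensor4Field d) :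
    Tensor4Field d :=
  fun y i' j' k' l' =>
    let x := φ.invFun y
    let D := jacobian Ω φ.toFun x
    ∑ i, ∑ j, ∑ k, ∑ l, c x i j k l * D i' i * D j' j * D k' k * D l' l

/-- The usual pushforward `φ_* g` of a covariant rank 2 tensor field, i.e. its pullback by the
inverse of `φ`. -/
def pushMetric {d : ℕ} {Ω : Set (E d)} (φ : BoundaryFixingDiffeo Ω) (g : MetricField d) :
    MetricField d :=
  fun y i' j' =>
    let D := jacobian Ω φ.invFun y
    ∑ i, ∑ j, g (φ.invFun y) i j * D i i' * D j j'

/-- The gauge transformation of triplets by a diffeomorphism `φ` and a function `μ`: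
`(ρ, c, g) ↦ (μ^{d/(2+d)} φ_* ρ, μ φ_* c, μ^{-2/(2+d)} φ_* g)`. -/
def gauge {d : ℕ} {Ω : Set (E d)} (φ : BoundaryFixingDiffeo Ω) (μ : E d → ℝ) (p : Triplet d) :
    Triplet d where
  ρ := fun x => (μ x) ^ ((d : ℝ) / (2 + d)) * pushDensity φ p.ρ x
  c := fun x i j k l => μ x * pushStiffness φ p.c x i j k l
  g := fun x => ((μ x) ^ (-(2 : ℝ) / (2 + d))) • pushMetric φ p.g x

/-! ### Sobolev spaces of vector fields -/

/-- `L²(Ω; ℝ^d)`. -/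
abbrev L2 {d : ℕ} (Ω : Set (E d)) : Type := Lp (E d) 2 (volume.restrict Ω)

/-- `L²` fields of linear maps `ℝ^d → ℝ^d`, in which the weak derivatives live. -/
abbrev L2D {d : ℕ} (Ω : Set (E d)) : Type := Lp (E d →L[ℝ] E d) 2 (volume.restrict Ω)

theorem test_integrable {d : ℕ} {F : Type*} [NormedAddCommGroup F] [NormedSpace ℝ F]
    {Ω : Set (E d)} {η : E d → ℝ} (hη : Continuous η) (hc : HasCompactSupport η)
    (u : Lp F 2 (volume.restrict Ω)) : Integrable (fun x => η x • u x) (volume.restrict Ω) :=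
  LocallyIntegrable.integrable_smul_left_of_hasCompactSupport
    ((Lp.memLp u).locallyIntegrable (by norm_num)) hη hc

/-- `U` is the weak derivative of `u` in `Ω`: for all `η ∈ C_c^∞(Ω)` and all directions `w`,
`∫_Ω (∂_w η) u = - ∫_Ω η (U w)`. -/
def IsWeakDeriv {d : ℕ} (Ω : Set (E d)) (u : L2 Ω) (U : L2D Ω) : Prop :=
  ∀ η : E d → ℝ, ContDiff ℝ ∞ η → HasCompactSupport η → tsupport η ⊆ Ω → ∀ w : E d,
    ∫ x in Ω, (fderiv ℝ η x w) • u x = - ∫ x in Ω, η x • (U x w)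

theorem test_fderiv {d : ℕ} {η : E d → ℝ} (hη : ContDiff ℝ ∞ η) (hc : HasCompactSupport η)
    (w : E d) : Continuous (fun x => fderiv ℝ η x w) ∧
      HasCompactSupport (fun x => fderiv ℝ η x w) :=
  ⟨(hη.continuous_fderiv (by simp)).clm_apply continuous_const, hc.fderiv_apply ℝ w⟩

theorem test_integrable_apply {d : ℕ} {Ω : Set (E d)} {η : E d → ℝ} (hη : Continuous η)
    (hc : HasCompactSupport η) (U : L2D Ω) (w : E d) :
    Integrable (fun x => η x • (U x w)) (volume.restrict Ω) := by
  simpa using (ContinuousLinearMap.apply ℝ (E d) w).integrable_comp (test_integrable hη hc U)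

theorem IsWeakDeriv.zero {d : ℕ} (Ω : Set (E d)) : IsWeakDeriv Ω 0 0 := by
  intro η hη hc hs w
  have h1 : ∫ x in Ω, (fderiv ℝ η x w) • (0 : L2 Ω) x = 0 := by
    rw [← integral_zero (E d) (E d) (μ := volume.restrict Ω)]
    refine integral_congr_ae ?_
    filter_upwards [Lp.coeFn_zero (E d) 2 (volume.restrict Ω)] with x hx
    rw [hx, Pi.zero_apply, smul_zero]
  have h2 : ∫ x in Ω, η x • ((0 : L2D Ω) x w) = 0 := by
    rw [← integral_zero (E d) (E d) (μ := volume.restrict Ω)]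
    refine integral_congr_ae ?_
    filter_upwards [Lp.coeFn_zero (E d →L[ℝ] E d) 2 (volume.restrict Ω)] with x hx
    rw [hx, Pi.zero_apply, zero_apply, smul_zero]
  rw [h1, h2, neg_zero]

theorem IsWeakDeriv.add {d : ℕ} {Ω : Set (E d)} {u v : L2 Ω} {U V : L2D Ω}
    (hu : IsWeakDeriv Ω u U) (hv : IsWeakDeriv Ω v V) : IsWeakDeriv Ω (u + v) (U + V) := by
  intro η hη hc hs w
  obtain ⟨hd, hdc⟩ := test_fderiv hη hc w
  have h1 : ∫ x in Ω, (fderiv ℝ η x w) • (u + v) x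
      = ∫ x in Ω, ((fderiv ℝ η x w) • u x + (fderiv ℝ η x w) • v x) := by
    refine integral_congr_ae ?_
    filter_upwards [Lp.coeFn_add u v] with x hx
    rw [hx, Pi.add_apply, smul_add]
  have h2 : ∫ x in Ω, η x • ((U + V) x w)
      = ∫ x in Ω, (η x • (U x w) + η x • (V x w)) := by
    refine integral_congr_ae ?_
    filter_upwards [Lp.coeFn_add U V] with x hx
    rw [hx, Pi.add_apply, add_apply, smul_add]
  rw [h1, h2, integral_add (test_integrable hd hdc u) (test_integrable hd hdc v),
    integral_add (test_integrable_apply hη.continuous hc U w)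
      (test_integrable_apply hη.continuous hc V w), hu η hη hc hs w, hv η hη hc hs w, neg_add]

theorem IsWeakDeriv.smul {d : ℕ} {Ω : Set (E d)} {u : L2 Ω} {U : L2D Ω} (a : ℝ)
    (hu : IsWeakDeriv Ω u U) : IsWeakDeriv Ω (a • u) (a • U) := by
  intro η hη hc hs w
  have h1 : ∫ x in Ω, (fderiv ℝ η x w) • (a • u) x
      = ∫ x in Ω, a • ((fderiv ℝ η x w) • u x) := by
    refine integral_congr_ae ?_
    filter_upwards [Lp.coeFn_smul a u] with x hx
    rw [hx, Pi.smul_apply, smul_comm]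
  have h2 : ∫ x in Ω, η x • ((a • U) x w) = ∫ x in Ω, a • (η x • (U x w)) := by
    refine integral_congr_ae ?_
    filter_upwards [Lp.coeFn_smul a U] with x hx
    rw [hx, Pi.smul_apply, smul_apply, smul_comm]
  rw [h1, h2, integral_smul, integral_smul, hu η hη hc hs w, smul_neg]

/-- The Sobolev space `H¹(Ω; ℝ^d)`: pairs of an `L²` vector field and its weak derivative, with
the graph norm. -/
def H1 {d : ℕ} (Ω : Set (E d)) : Submodule ℝ (L2 Ω × L2D Ω) where
  carrier := {p | IsWeakDeriv Ω p.1 p.2}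
  zero_mem' := IsWeakDeriv.zero Ω
  add_mem' := fun hu hv => IsWeakDeriv.add hu hv
  smul_mem' := fun a _ hu => IsWeakDeriv.smul a hu

/-- The underlying `L²` vector field of an element of `H¹`. -/
def H1.val {d : ℕ} {Ω : Set (E d)} (u : H1 Ω) : L2 Ω := (u : L2 Ω × L2D Ω).1

/-- The weak derivative of an element of `H¹`. -/
def H1.deriv {d : ℕ} {Ω : Set (E d)} (u : H1 Ω) : L2D Ω := (u : L2 Ω × L2D Ω).2

/-- `H¹₀(Ω; ℝ^d)`: the closure of `C_c^∞(Ω; ℝ^d)` in `H¹(Ω; ℝ^d)`. -/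
def H10 {d : ℕ} (Ω : Set (E d)) : Submodule ℝ (H1 Ω) :=
  (Submodule.span ℝ {u : H1 Ω | ∃ v : E d → E d, ContDiff ℝ ∞ v ∧ HasCompactSupport v ∧
    tsupport v ⊆ Ω ∧ H1.val u =ᵐ[volume.restrict Ω] v}).topologicalClosure

instance isClosed_H10 {d : ℕ} (Ω : Set (E d)) : IsClosed (H10 Ω : Set (H1 Ω)) :=
  Submodule.isClosed_topologicalClosure _

/-- The trace space `H^{1/2}(∂Ω; ℝ^d)`, realized as `H¹(Ω) / H¹₀(Ω)` with the quotient norm. -/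
def TraceSpace {d : ℕ} (Ω : Set (E d)) : Type := H1 Ω ⧸ H10 Ω

instance instNormedAddCommGroupTraceSpace {d : ℕ} (Ω : Set (E d)) :
    NormedAddCommGroup (TraceSpace Ω) :=
  inferInstanceAs (NormedAddCommGroup (H1 Ω ⧸ H10 Ω))

instance instNormedSpaceTraceSpace {d : ℕ} (Ω : Set (E d)) :
    NormedSpace ℝ (TraceSpace Ω) :=
  inferInstanceAs (NormedSpace ℝ (H1 Ω ⧸ H10 Ω))

/-- The boundary trace `u ↦ u|_{∂Ω}`. -/
def trace {d : ℕ} {Ω : Set (E d)} (u : H1 Ω) : TraceSpace Ω :=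
  (Submodule.Quotient.mk u : H1 Ω ⧸ H10 Ω)

/-- `H^{-1/2}(∂Ω; ℝ^d)`, the dual of `H^{1/2}(∂Ω; ℝ^d)`. -/
abbrev DualTraceSpace {d : ℕ} (Ω : Set (E d)) : Type := TraceSpace Ω →L[ℝ] ℝ

/-! ### The Euclidean elastic wave equation and its Dirichlet-to-Neumann map -/

/-- The elastic bilinear form `∫_Ω c_{ijkl} (∂_k u_l) (∂_j v_i) dx`. -/
def elasticForm {d : ℕ} {Ω : Set (E d)} (c : Tensor4Field d) (u v : H1 Ω) : ℝ :=
  ∫ x in Ω, ∑ i, ∑ j, ∑ k, ∑ l,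
    c x i j k l * (H1.deriv u x (e k)) l * (H1.deriv v x (e j)) i

/-- The weighted inner product `∫_Ω ρ u · v dx`. -/
def massForm {d : ℕ} {Ω : Set (E d)} (ρ : E d → ℝ) (u v : L2 Ω) : ℝ :=
  ∫ x in Ω, ρ x * ⟪u x, v x⟫_ℝ

/-- `u ∈ C([0,T]; H¹) ∩ C¹([0,T]; L²)`, with time derivative `u'`, is the weak solution of
`ρ ∂_t² u_i = ∂_j (c_{ijkl} ∂_k u_l)` in `(0,T) × Ω`, `u = f` on `(0,T) × ∂Ω`,
`u(0) = ∂_t u(0) = 0`. The equation is tested against `H¹₀` and integrated once in time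
(using `∂_t u(0) = 0`). -/
structure IsWeakSolution {d : ℕ} (Ω : Set (E d)) (T : ℝ) (ρ : E d → ℝ) (c : Tensor4Field d)
    (f : ℝ → TraceSpace Ω) (u : ℝ → H1 Ω) (u' : ℝ → L2 Ω) : Prop where
  cont : ContinuousOn u (Icc 0 T)
  cont' : ContinuousOn u' (Icc 0 T)
  hasDeriv : ∀ t ∈ Icc 0 T, HasDerivWithinAt (fun s => H1.val (u s)) (u' t) (Icc 0 T) t
  init : u 0 = 0
  init' : u' 0 = 0
  boundary : ∀ t ∈ Icc 0 T, trace (u t) = f t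
  equation : ∀ t ∈ Icc 0 T, ∀ v ∈ H10 Ω,
    massForm ρ (u' t) (H1.val v) + ∫ s in (0 : ℝ)..t, elasticForm c (u s) v = 0

/-- Dirichlet data: `f ∈ C²([0,T]; H^{1/2}(∂Ω))` with `f(0) = ∂_t f(0) = 0`. -/
def IsDirichletDatum {d : ℕ} (Ω : Set (E d)) (T : ℝ) (f : ℝ → TraceSpace Ω) : Prop :=
  ContDiffOn ℝ 2 f (Icc 0 T) ∧ f 0 = 0 ∧ derivWithin f (Icc 0 T) 0 = 0

/-- The Euclidean Dirichlet-to-Neumann map `Λ_(ρ,c)` on `(0,T) × ∂Ω`, as its graph: the pairs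
`(f, h)` of a Dirichlet datum `f ∈ C²([0,T]; H^{1/2}(∂Ω))` and the corresponding Neumann datum
`h ∈ L²(0,T; H^{-1/2}(∂Ω))`, `h_i = ν_j c_{ijkl} ∂_k u_l`. In the weak sense, by Green's formula,
the traction `h` of a solution `u` is determined by
`⟨h(t), v|_{∂Ω}⟩ = d/dt ∫_Ω ρ ∂_t u(t) · v dx + ∫_Ω c_{ijkl} ∂_k u_l(t) ∂_j v_i dx` for all
`v ∈ H¹(Ω; ℝ^d)`; this identity is integrated once in time. -/
def dnMap {d : ℕ} (Ω : Set (E d)) (T : ℝ) (ρ : E d → ℝ) (c : Tensor4Field d) :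
    Set ({f : ℝ → TraceSpace Ω // IsDirichletDatum Ω T f} ×
      Lp (DualTraceSpace Ω) 2 (volume.restrict (Icc 0 T))) :=
  {p | ∃ (u : ℝ → H1 Ω) (u' : ℝ → L2 Ω), IsWeakSolution Ω T ρ c p.1 u u' ∧
    ∀ t ∈ Icc 0 T, ∀ v : H1 Ω,
      ∫ s in (0 : ℝ)..t, (p.2 s) (trace v) =
        massForm ρ (u' t) (H1.val v) + ∫ s in (0 : ℝ)..t, elasticForm c (u s) v}

/-- The pair `(φ, μ)` is a gauge freedom of the Euclidean Dirichlet-to-Neumann map `Λ_(ρ,c)`: the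
gauge transformation turns `(ρ, c, g_E)` into a triplet `(ρ', c', g_E)` with the Euclidean metric
again, and `Λ_(ρ',c') = Λ_(ρ,c)`. -/
def IsEuclideanDNGauge {d : ℕ} (Ω : Set (E d)) (T : ℝ) (ρ : E d → ℝ) (c : Tensor4Field d)
    (φ : BoundaryFixingDiffeo Ω) (μ : E d → ℝ) : Prop :=
  ∃ (ρ' : E d → ℝ) (c' : Tensor4Field d),
    (gauge φ μ ⟨ρ, c, euclideanMetric d⟩).EqOn ⟨ρ', c', euclideanMetric d⟩ (closure Ω) ∧
    dnMap Ω T ρ' c' = dnMap Ω T ρ c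

end ElasticGauge

end

/-! The whole theorem rests on the metric component. If the new metric is Euclidean, then `ψ = φ⁻¹`
satisfies `s DψᵀDψ = 1` with `s = μ^{-2/(2+d)}`, so `ψ` is a conformal diffeomorphism of `closure Ω`
that fixes the boundary. Such a map is the identity, by a sharp inequality in integrated form.

Pointwise, `Dψ` is `l = s^{-1/2}` times an orthogonal matrix, hence `tr Dψ ≤ d l ≤ l^d + (d-1) =
|det Dψ| + (d-1)` (`trace_le_of_conformal`). Both ends have the same integral: `ψ - id` vanishes on
the boundary, so `∫ tr Dψ = d vol` (`setIntegral_trace_jacobian`), while the change of variables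
formula gives `∫ |det Dψ| = vol`. By continuity equality holds at every point, which forces `Dψ = 1`
and `s = 1` (`jacobian_eq_one_of_conformal`). Then `ψ = id`, and `μ = 1` because `μ` is positive.
Neither Liouville's theorem nor complex analysis enters, and the two dimensions are treated alike.

The divergence identity avoids Stokes' theorem on `Ω`: a function vanishing on the boundary extends
by zero to a compactly supported Lipschitz function, whose directional derivatives have integral
zero. -/

namespace ElasticGauge

/-! ### Tangent cones of smooth domains -/

/-- A smooth domain has unique derivatives up to the boundary. -/
theorem IsSmoothDomain.uniqueDiffOn_closure {d : ℕ} {Ω : Set (E d)} (hΩ : IsSmoothDomain Ω) :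
    UniqueDiffOn ℝ (closure Ω) := by
  intro x hx
  by_cases hxΩ : x ∈ Ω
  · exact (hΩ.1.uniqueDiffWithinAt hxΩ).closure
  obtain ⟨r, hr, hr0, U, hU, hUΩ⟩ := hΩ.2 x ⟨hx, by rwa [hΩ.1.interior_eq]⟩
  have hrx : r x ≤ 0 := by
    by_contra! hpos
    obtain ⟨y, ⟨hyU, hyr⟩, hyΩ⟩ := mem_closure_iff_nhds.1 hx _
      (Filter.inter_mem hU (hr.continuous.continuousAt.eventually (lt_mem_nhds hpos)))
    exact absurd ((hUΩ y hyU).1 hyΩ) (not_lt.2 (le_of_lt hyr))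
  have hder : HasFDerivAt r (fderiv ℝ r x) x := (hr.differentiable (by simp) x).hasFDerivAt
  -- Short steps in a direction of first-order decrease of `r` enter `Ω`, so the tangent cone
  -- contains a nonempty open half-space, and this spans.
  have hcone : {v | fderiv ℝ r x v < 0} ⊆ tangentConeAt ℝ Ω x := by
    intro v hv
    have hline : HasDerivAt (fun t : ℝ => r (x + t • v)) (fderiv ℝ r x v) 0 := by
      have h := hder.hasLineDerivAt v
      exact h
    have hdecr : ∀ᶠ t in 𝓝[>] (0 : ℝ), r (x + t • v) < r x := by
      have h := (hasDerivWithinAt_iff_tendsto_slope' (s := Ioi (0 : ℝ)) (by simp)).1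
        hline.hasDerivWithinAt
      filter_upwards [h.eventually (gt_mem_nhds hv), self_mem_nhdsWithin] with t ht ht0
      rw [slope_def_field] at ht
      have ht0' : (0 : ℝ) < t := ht0
      have := (div_neg_iff.1 ht).resolve_left (by intro h; linarith [h.2])
      simpa using this.1
    have hnear : ∀ᶠ t in 𝓝[>] (0 : ℝ), x + t • v ∈ U := by
      have hc : Continuous (fun t : ℝ => x + t • v) := by fun_prop
      refine (hc.tendsto' 0 x (by simp)).mono_left nhdsWithin_le_nhds |>.eventually hU
    refine mem_tangentConeAt_of_add_smul_mem (l := 𝓝[>] (0 : ℝ)) (c := id) ?_ ?_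
    · exact Filter.tendsto_id'.2 (nhdsGT_le_nhdsNE 0)
    · filter_upwards [hdecr, hnear] with t h1 h2
      exact (hUΩ _ h2).2 (h1.trans_le hrx)
  have hopen : IsOpen {v | fderiv ℝ r x v < 0} :=
    isOpen_lt (fderiv ℝ r x).continuous continuous_const
  have hne : {v | fderiv ℝ r x v < 0}.Nonempty := by
    obtain ⟨v, hv⟩ : ∃ v, fderiv ℝ r x v ≠ 0 := by
      by_contra! h
      exact hr0 (ContinuousLinearMap.ext h)
    rcases lt_or_gt_of_ne hv with h | h
    · exact ⟨v, h⟩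
    · exact ⟨-v, by simpa using h⟩
  have hspan : Submodule.span ℝ (tangentConeAt ℝ Ω x) = ⊤ := by
    refine Submodule.eq_top_of_nonempty_interior' _ ?_
    exact hne.mono (interior_maximal (hcone.trans Submodule.subset_span) hopen)
  exact UniqueDiffWithinAt.closure ⟨by rw [hspan]; exact dense_univ, hx⟩

/-! ### Functions vanishing on the boundary -/

section ZeroExtension

variable {V : Type*} [NormedAddCommGroup V] [NormedSpace ℝ V] {Ω : Set V} {f : V → ℝ} {L : ℝ}

/-- Inside an open set, a function that vanishes on the boundary and has bounded derivative is
controlled by the distance to any exterior point. -/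
theorem abs_le_mul_norm_sub_of_eqOn_frontier (hΩ : IsOpen Ω)
    (hf : DifferentiableOn ℝ f (closure Ω))
    (hL : ∀ x ∈ Ω, ‖fderiv ℝ f x‖ ≤ L) (h0 : ∀ x ∈ frontier Ω, f x = 0)
    {x y : V} (hx : x ∈ Ω) (hy : y ∉ Ω) : |f x| ≤ L * ‖y - x‖ := by
  have hL0 : 0 ≤ L := (norm_nonneg _).trans (hL x hx)
  set p : ℝ → V := fun t => x + t • (y - x) with hp
  have hpc : Continuous p := by fun_prop
  set S : Set ℝ := Icc 0 1 ∩ p ⁻¹' Ωᶜ with hS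
  have hScomp : IsCompact S := isCompact_Icc.inter_right (hΩ.isClosed_compl.preimage hpc)
  -- `a` is the first time at which the segment from `x` to `y` leaves `Ω`. There `f` vanishes, and
  -- before it the derivative bound applies.
  obtain ⟨a, haS, hamin⟩ := hScomp.exists_isLeast ⟨1, ⟨by simp, by simpa [hp] using hy⟩⟩
  have ha0 : 0 < a := by
    rcases haS.1.1.lt_or_eq with h | h
    · exact h
    · exfalso
      have := haS.2
      rw [← h] at this
      exact this (by simpa [hp] using hx)
  have hin : ∀ t ∈ Ico 0 a, p t ∈ Ω := by
    intro t ht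
    by_contra hcon
    exact absurd (hamin ⟨⟨ht.1, ht.2.le.trans haS.1.2⟩, hcon⟩) (not_le.2 ht.2)
  have hcl : ∀ t ∈ Icc 0 a, p t ∈ closure Ω := by
    intro t ht
    have : t ∈ closure (Ico 0 a) := by rwa [closure_Ico ha0.ne]
    exact map_mem_closure hpc this hin
  have hfr : f (p a) = 0 :=
    h0 _ ⟨hcl a ⟨ha0.le, le_rfl⟩, by rw [hΩ.interior_eq]; exact haS.2⟩
  have hder : ∀ t ∈ Ico 0 a,
      HasDerivWithinAt (fun t => f (p t)) (fderiv ℝ f (p t) (y - x)) (Ici t) t := by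
    intro t ht
    have h1 : HasFDerivAt f (fderiv ℝ f (p t)) (p t) :=
      (hf.differentiableAt (Filter.mem_of_superset (hΩ.mem_nhds (hin t ht))
        subset_closure)).hasFDerivAt
    have h2 : HasDerivAt p (y - x) t := by
      simpa [hp] using ((hasDerivAt_id t).smul_const (y - x)).const_add x
    exact (h1.comp_hasDerivAt t h2).hasDerivWithinAt
  have key := norm_image_sub_le_of_norm_deriv_right_le_segment (C := L * ‖y - x‖)
    (hf.continuousOn.comp hpc.continuousOn hcl) hder (fun t ht =>
      ((fderiv ℝ f (p t)).le_opNorm _).trans (by gcongr; exact hL _ (hin t ht))) a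
      ⟨ha0.le, le_rfl⟩
  have hp0 : p 0 = x := by simp [hp]
  simp only [Function.comp_apply, hfr, hp0, zero_sub, norm_neg, sub_zero, Real.norm_eq_abs] at key
  calc |f x| ≤ L * ‖y - x‖ * a := key
    _ ≤ L * ‖y - x‖ * 1 := by gcongr; exact haS.1.2
    _ = _ := mul_one _

/-- The extension by zero of a function vanishing on the boundary is Lipschitz. -/
theorem lipschitzWith_indicator_closure (hΩ : IsOpen Ω)
    (hf : DifferentiableOn ℝ f (closure Ω)) (hL0 : 0 ≤ L)
    (hL : ∀ x ∈ Ω, ‖fderiv ℝ f x‖ ≤ L) (h0 : ∀ x ∈ frontier Ω, f x = 0) :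
    LipschitzWith L.toNNReal ((closure Ω).indicator f) := by
  have hval : ∀ x ∈ Ω, (closure Ω).indicator f x = f x := fun x hx =>
    indicator_of_mem (subset_closure hx) f
  have hval0 : ∀ x ∉ Ω, (closure Ω).indicator f x = 0 := by
    intro x hx
    by_cases hxc : x ∈ closure Ω
    · rw [indicator_of_mem hxc, h0 x ⟨hxc, by rwa [hΩ.interior_eq]⟩]
    · exact indicator_of_notMem hxc f
  refine LipschitzWith.of_dist_le_mul fun x y => ?_
  rw [Real.coe_toNNReal L hL0, Real.dist_eq, dist_eq_norm]
  by_cases hx : x ∈ Ω <;> by_cases hy : y ∈ Ω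
  · rw [hval x hx, hval y hy]
    -- `Ω` need not be convex. If the segment leaves `Ω` at `z`, both values are bounded through
    -- `z`, and the two distances add up to `‖x - y‖`.
    by_cases hseg : segment ℝ x y ⊆ Ω
    · have := (convex_segment x y).norm_image_sub_le_of_norm_fderiv_le (𝕜 := ℝ) (f := f) (C := L)
        (fun z hz => hf.differentiableAt (Filter.mem_of_superset (hΩ.mem_nhds (hseg hz))
          subset_closure)) (fun z hz => hL z (hseg hz)) (right_mem_segment ℝ x y)
        (left_mem_segment ℝ x y)
      simpa using this
    · obtain ⟨z, hz, hzΩ⟩ := not_subset.1 hseg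
      have h1 := abs_le_mul_norm_sub_of_eqOn_frontier hΩ hf hL h0 hx hzΩ
      have h2 := abs_le_mul_norm_sub_of_eqOn_frontier hΩ hf hL h0 hy hzΩ
      have h3 : ‖z - x‖ + ‖z - y‖ = ‖x - y‖ := by
        have := dist_add_dist_of_mem_segment hz
        rwa [dist_comm x z, dist_eq_norm, dist_eq_norm, dist_eq_norm] at this
      calc |f x - f y| ≤ |f x| + |f y| := abs_sub _ _
        _ ≤ L * ‖z - x‖ + L * ‖z - y‖ := add_le_add h1 h2
        _ = L * ‖x - y‖ := by rw [← mul_add, h3]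
  · rw [hval x hx, hval0 y hy, sub_zero, norm_sub_rev]
    exact abs_le_mul_norm_sub_of_eqOn_frontier hΩ hf hL h0 hx hy
  · rw [hval0 x hx, hval y hy, zero_sub, abs_neg]
    exact abs_le_mul_norm_sub_of_eqOn_frontier hΩ hf hL h0 hy hx
  · rw [hval0 x hx, hval0 y hy, sub_zero, abs_zero]
    positivity

/-- The integral of a derivative of a function that vanishes on the boundary is zero. -/
theorem setIntegral_fderivWithin_closure_eq_zero [FiniteDimensional ℝ V] [MeasurableSpace V]
    [BorelSpace V] (m : Measure V) [m.IsAddHaarMeasure] (hΩ : IsOpen Ω)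
    (hbdd : Bornology.IsBounded Ω) (hu : UniqueDiffOn ℝ (closure Ω))
    (hf : DifferentiableOn ℝ f (closure Ω)) (hL0 : 0 ≤ L)
    (hL : ∀ x ∈ Ω, ‖fderiv ℝ f x‖ ≤ L) (h0 : ∀ x ∈ frontier Ω, f x = 0) (v : V) :
    ∫ x in closure Ω, fderivWithin ℝ f (closure Ω) x v ∂m = 0 := by
  set F := (closure Ω).indicator f with hF
  have hLip : LipschitzWith L.toNNReal F := lipschitzWith_indicator_closure hΩ hf hL0 hL h0
  have hcomp : IsCompact (closure Ω) := hbdd.isCompact_closure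
  have hFsupp : HasCompactSupport F :=
    HasCompactSupport.intro hcomp fun x hx => indicator_of_notMem hx f
  -- By Rademacher `F` is differentiable almost everywhere. At such a point of `closure Ω`, even on
  -- the frontier, unique differentiability identifies the two derivatives, so the frontier need not
  -- be a null set.
  have hae : ∀ᵐ x ∂m, lineDeriv ℝ F x v
      = (closure Ω).indicator (fun x => fderivWithin ℝ f (closure Ω) x v) x := by
    filter_upwards [hLip.ae_differentiableAt (μ := m)] with x hx
    rw [hx.lineDeriv_eq_fderiv]
    by_cases hxc : x ∈ closure Ω
    · have : HasFDerivWithinAt f (fderiv ℝ F x) (closure Ω) x :=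
        hx.hasFDerivAt.hasFDerivWithinAt.congr
          (fun y hy => (indicator_of_mem hy f).symm) (indicator_of_mem hxc f).symm
      rw [indicator_of_mem hxc, this.fderivWithin (hu x hxc)]
    · have : F =ᶠ[𝓝 x] fun _ => (0 : ℝ) := by
        filter_upwards [isClosed_closure.isOpen_compl.mem_nhds hxc] with y hy
        exact indicator_of_notMem hy f
      rw [indicator_of_notMem hxc, this.fderiv_eq, fderiv_fun_const]
      rfl
  have hone : LipschitzWith 0 (fun _ : V => (1 : ℝ)) := LipschitzWith.const 1
  -- Integration by parts against the constant `1`; the formula flips the direction, hence `-v`.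
  have hparts := hone.integral_lineDeriv_mul_eq (μ := m) hLip hFsupp (-v)
  rw [← integral_indicator isClosed_closure.measurableSet, ← integral_congr_ae hae]
  simpa [lineDeriv] using hparts.symm

end ZeroExtension

/-! ### Conformal matrices -/

/-- `D` is `l = s^{-1/2}` times an orthogonal matrix: its entries are at most `l` and `|det D| =
l^d`, so the bound reduces to Bernoulli's inequality `d l ≤ l^d + (d-1)`. Equality forces `l = 1`
and a diagonal of ones, and unit columns leave no room for other entries. The absolute value makes
orientation irrelevant. -/
theorem trace_le_of_conformal {d : ℕ} (hd : d = 2 ∨ d = 3) {D : Matrix (Fin d) (Fin d) ℝ} {s : ℝ}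
    (h : s • (D.transpose * D) = 1) :
    D.trace ≤ |D.det| + (d - 1) ∧ (D.trace = |D.det| + (d - 1) → D = 1 ∧ s = 1) := by
  have hcol : ∀ j, s * ∑ k, D k j ^ 2 = 1 := by
    intro j
    have := congrFun (congrFun h j) j
    simpa [Matrix.mul_apply, sq] using this
  have j₀ : Fin d := ⟨0, by omega⟩
  have hs : 0 < s := by
    by_contra! hs
    have := hcol j₀
    nlinarith [Finset.sum_nonneg fun k (_ : k ∈ Finset.univ) => sq_nonneg (D k j₀)]
  set l : ℝ := (√s)⁻¹ with hl
  have hl0 : 0 < l := by positivity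
  have hl2 : l ^ 2 = s⁻¹ := by rw [hl, inv_pow, Real.sq_sqrt hs.le]
  have hcol' : ∀ j, ∑ k, D k j ^ 2 = l ^ 2 := by
    intro j
    rw [hl2]
    exact eq_inv_of_mul_eq_one_right (hcol j)
  have hentry : ∀ k j, D k j ^ 2 ≤ l ^ 2 := fun k j => by
    rw [← hcol' j]
    exact Finset.single_le_sum (f := fun k => D k j ^ 2) (fun i _ => sq_nonneg _)
      (Finset.mem_univ k)
  have hdiag : ∀ j, D j j ≤ l := fun j => (abs_le_of_sq_le_sq' (hentry j j) hl0.le).2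
  have htr : D.trace ≤ d * l := by
    calc D.trace = ∑ j, D j j := rfl
      _ ≤ ∑ _j : Fin d, l := Finset.sum_le_sum fun j _ => hdiag j
      _ = d * l := by simp
  have hdet : |D.det| = l ^ d := by
    have h1 : s ^ d * D.det ^ 2 = 1 := by
      have := congrArg Matrix.det h
      rw [Matrix.det_smul, Matrix.det_mul, Matrix.det_transpose, Matrix.det_one] at this
      simpa [sq] using this
    have h2 : D.det ^ 2 = (l ^ d) ^ 2 := by
      rw [← pow_mul, mul_comm d 2, pow_mul, hl2, inv_pow]
      exact eq_inv_of_mul_eq_one_right h1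
    rw [← abs_of_pos (pow_pos hl0 d)]
    exact sq_eq_sq_iff_abs_eq_abs _ _ |>.1 h2
  -- The difference of the two sides is `(l-1)²` for `d = 2` and `(l-1)²(l+2)` for `d = 3`.
  have hbern : d * l ≤ l ^ d + (d - 1) ∧ (d * l = l ^ d + (d - 1) → l = 1) := by
    rcases hd with rfl | rfl
    · refine ⟨by push_cast; nlinarith [sq_nonneg (l - 1)], fun he => ?_⟩
      push_cast at he
      have : (l - 1) ^ 2 = 0 := by linarith
      linarith [pow_eq_zero_iff two_ne_zero |>.1 this]
    · refine ⟨by push_cast; nlinarith [mul_nonneg (sq_nonneg (l - 1)) (by linarith : 0 ≤ l + 2)],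
        fun he => ?_⟩
      push_cast at he
      have : (l - 1) ^ 2 * (l + 2) = 0 := by linarith
      rcases mul_eq_zero.1 this with h | h
      · linarith [pow_eq_zero_iff two_ne_zero |>.1 h]
      · linarith
  rw [hdet]
  refine ⟨htr.trans hbern.1, fun he => ?_⟩
  have hl1 : l = 1 := hbern.2 (le_antisymm hbern.1 (he ▸ htr))
  have hs1 : s = 1 := by
    rw [hl1, one_pow] at hl2
    rw [← inv_inv s, ← hl2, inv_one]
  have hdiag1 : ∀ j, D j j = 1 := by
    have hsum : ∑ j, D j j = ∑ _j : Fin d, (1 : ℝ) := by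
      have : D.trace = d := by rw [he, hl1]; ring
      simpa [Matrix.trace] using this
    have := (Finset.sum_eq_sum_iff_of_le fun j _ => hl1 ▸ hdiag j).1 hsum
    exact fun j => this j (Finset.mem_univ j)
  refine ⟨?_, hs1⟩
  ext k j
  rcases eq_or_ne k j with rfl | hkj
  · rw [hdiag1, Matrix.one_apply_eq]
  · rw [Matrix.one_apply_ne hkj]
    -- Column `j` has squared length `1`, already used up by its diagonal entry.
    have h1 := Finset.add_le_sum (f := fun k => D k j ^ 2) (fun i _ => sq_nonneg _)
      (Finset.mem_univ k) (Finset.mem_univ j) hkj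
    rw [hcol' j, hl1, hdiag1 j] at h1
    have : D k j ^ 2 = 0 := le_antisymm (by linarith) (sq_nonneg _)
    exact pow_eq_zero_iff two_ne_zero |>.1 this

/-! ### Rigidity of conformal diffeomorphisms fixing the boundary -/

theorem det_jacobian {d : ℕ} (Ω : Set (E d)) (f : E d → E d) (x : E d) :
    (jacobian Ω f x).det = (fderivWithin ℝ f (closure Ω) x).det := by
  rw [ContinuousLinearMap.det,
    ← LinearMap.det_toMatrix (EuclideanSpace.basisFun (Fin d) ℝ).toBasis]
  congr 1

theorem fderivWithin_eq_id_of_jacobian_eq_one {d : ℕ} {Ω : Set (E d)} {f : E d → E d} {x : E d}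
    (h : jacobian Ω f x = 1) :
    fderivWithin ℝ f (closure Ω) x = ContinuousLinearMap.id ℝ (E d) := by
  refine ContinuousLinearMap.coe_injective
    ((EuclideanSpace.basisFun (Fin d) ℝ).toBasis.ext fun j => ?_)
  ext i
  have := congrFun (congrFun h i) j
  simpa [jacobian, Matrix.one_apply, Pi.single_apply] using this

theorem jacobian_eq_one_of_eqOn_id {d : ℕ} {Ω : Set (E d)} (hu : UniqueDiffOn ℝ (closure Ω))
    {f : E d → E d} (hf : ∀ x ∈ closure Ω, f x = x) {x : E d} (hx : x ∈ closure Ω) :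
    jacobian Ω f x = 1 := by
  have h : fderivWithin ℝ f (closure Ω) x = ContinuousLinearMap.id ℝ (E d) :=
    ((hasFDerivWithinAt_id x _).congr hf (hf x hx)).fderivWithin (hu x hx)
  ext i j
  simp [jacobian, h, Matrix.one_apply]

section Rigidity

variable {d : ℕ} {Ω : Set (E d)} {ψ : E d → E d}

theorem continuousOn_fderivWithin_closure (hu : UniqueDiffOn ℝ (closure Ω))
    (hψ : ContDiffOn ℝ ∞ ψ (closure Ω)) :
    ContinuousOn (fun x => fderivWithin ℝ ψ (closure Ω) x) (closure Ω) :=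
  hψ.continuousOn_fderivWithin hu (by simp)

theorem continuousOn_jacobian (hu : UniqueDiffOn ℝ (closure Ω))
    (hψ : ContDiffOn ℝ ∞ ψ (closure Ω)) :
    ContinuousOn (fun x => jacobian Ω ψ x) (closure Ω) := by
  have h := continuousOn_fderivWithin_closure hu hψ
  refine continuousOn_pi.2 fun i => continuousOn_pi.2 fun j => ?_
  exact (EuclideanSpace.proj (𝕜 := ℝ) i).continuous.comp_continuousOn
    (h.clm_apply continuousOn_const)

/-- The components of the displacement `ψ - id`, with their derivatives. -/
theorem hasFDerivWithinAt_displacement (hψ : ContDiffOn ℝ ∞ ψ (closure Ω)) (i : Fin d) {x : E d}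
    (hx : x ∈ closure Ω) :
    HasFDerivWithinAt (fun y => (ψ y - y) i)
      ((EuclideanSpace.proj (𝕜 := ℝ) i).comp
        (fderivWithin ℝ ψ (closure Ω) x - ContinuousLinearMap.id ℝ (E d))) (closure Ω) x :=
  (EuclideanSpace.proj (𝕜 := ℝ) i).hasFDerivAt.comp_hasFDerivWithinAt x
    (((hψ.differentiableOn (by simp)) x hx).hasFDerivWithinAt.sub (hasFDerivWithinAt_id x _))

theorem hasFDerivAt_displacement (hΩ : IsOpen Ω) (hψ : ContDiffOn ℝ ∞ ψ (closure Ω)) (i : Fin d)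
    {x : E d} (hx : x ∈ Ω) :
    HasFDerivAt (fun y => (ψ y - y) i)
      ((EuclideanSpace.proj (𝕜 := ℝ) i).comp
        (fderivWithin ℝ ψ (closure Ω) x - ContinuousLinearMap.id ℝ (E d))) x :=
  (hasFDerivWithinAt_displacement hψ i (subset_closure hx)).hasFDerivAt
    (Filter.mem_of_superset (hΩ.mem_nhds hx) subset_closure)

/-- If `ψ` fixes the boundary, then `∫ div ψ = d vol`. -/
theorem setIntegral_trace_jacobian (hΩ : IsOpen Ω) (hbdd : Bornology.IsBounded Ω)
    (hu : UniqueDiffOn ℝ (closure Ω)) (hψ : ContDiffOn ℝ ∞ ψ (closure Ω))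
    (hfix : ∀ x ∈ frontier Ω, ψ x = x) :
    ∫ x in closure Ω, (jacobian Ω ψ x).trace = d * volume.real (closure Ω) := by
  have hcomp : IsCompact (closure Ω) := hbdd.isCompact_closure
  have hcont := continuousOn_jacobian hu hψ
  have hentry : ∀ i, IntegrableOn (fun x => jacobian Ω ψ x i i) (closure Ω) := fun i =>
    (continuousOn_pi.1 (continuousOn_pi.1 hcont i) i).integrableOn_compact hcomp
  have hi : ∀ i, ∫ x in closure Ω, jacobian Ω ψ x i i = volume.real (closure Ω) := by
    intro i
    obtain ⟨L, hL⟩ := hcomp.exists_bound_of_continuousOn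
      (f := fun x => (EuclideanSpace.proj (𝕜 := ℝ) i).comp
        (fderivWithin ℝ ψ (closure Ω) x - ContinuousLinearMap.id ℝ (E d)))
      (continuousOn_const.clm_comp
        ((continuousOn_fderivWithin_closure hu hψ).sub continuousOn_const))
    -- The bound from compactness carries no sign, hence `max L 0`.
    have hzero := setIntegral_fderivWithin_closure_eq_zero (L := max L 0)
      (f := fun y => (ψ y - y) i) (volume : Measure (E d)) hΩ hbdd hu
      (fun x hx => (hasFDerivWithinAt_displacement hψ i hx).differentiableWithinAt)
      (le_max_right _ _)
      (fun x hx => by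
        rw [(hasFDerivAt_displacement hΩ hψ i hx).fderiv]
        exact (hL x (subset_closure hx)).trans (le_max_left _ _))
      (fun x hx => by simp [hfix x hx]) (e i)
    have hcongr : ∀ x ∈ closure Ω,
        fderivWithin ℝ (fun y => (ψ y - y) i) (closure Ω) x (e i) = jacobian Ω ψ x i i - 1 := by
      intro x hx
      rw [(hasFDerivWithinAt_displacement hψ i hx).fderivWithin (hu x hx)]
      simp [jacobian]
    rw [setIntegral_congr_fun isClosed_closure.measurableSet hcongr,
      integral_sub (hentry i) (integrableOn_const hcomp.measure_lt_top.ne)] at hzero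
    simpa [sub_eq_zero] using hzero
  simp only [Matrix.trace, Matrix.diag]
  rw [integral_finsetSum _ fun i _ => hentry i]
  simp [hi]

/-- A diffeomorphism of `closure Ω` that is conformal and fixes the boundary has derivative `1`,
and its conformal factor is `1`. -/
theorem jacobian_eq_one_of_conformal (hd : d = 2 ∨ d = 3) (hΩ : IsOpen Ω)
    (hbdd : Bornology.IsBounded Ω) (hu : UniqueDiffOn ℝ (closure Ω))
    (hψ : ContDiffOn ℝ ∞ ψ (closure Ω)) (hinj : InjOn ψ (closure Ω))
    (himage : ψ '' closure Ω = closure Ω) (hfix : ∀ x ∈ frontier Ω, ψ x = x) {s : E d → ℝ}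
    (hs : ∀ x ∈ closure Ω, s x • ((jacobian Ω ψ x).transpose * jacobian Ω ψ x) = 1) :
    ∀ x ∈ closure Ω, jacobian Ω ψ x = 1 ∧ s x = 1 := by
  have hcomp : IsCompact (closure Ω) := hbdd.isCompact_closure
  have hcont := continuousOn_jacobian hu hψ
  have htr : ContinuousOn (fun x => (jacobian Ω ψ x).trace) (closure Ω) := by
    have : Continuous (fun A : Matrix (Fin d) (Fin d) ℝ => A.trace) := by fun_prop
    exact this.comp_continuousOn hcont
  have hdet : ContinuousOn (fun x => |(jacobian Ω ψ x).det|) (closure Ω) := by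
    have : Continuous (fun A : Matrix (Fin d) (Fin d) ℝ => |A.det|) :=
      (continuous_id.matrix_det).abs
    exact this.comp_continuousOn hcont
  have hvol : ∫ x in closure Ω, |(jacobian Ω ψ x).det| = volume.real (closure Ω) := by
    have := integral_image_eq_integral_abs_det_fderiv_smul (volume : Measure (E d))
      isClosed_closure.measurableSet
      (fun x hx => ((hψ.differentiableOn (by simp)) x hx).hasFDerivWithinAt) hinj
      (fun _ => (1 : ℝ))
    rw [himage] at this
    simp only [det_jacobian]
    simpa using this.symm
  -- The nonnegative gap in the trace inequality integrates to `vol + (d-1) vol - d vol`.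
  have hint : ∫ x in closure Ω,
      (|(jacobian Ω ψ x).det| + ((d : ℝ) - 1) - (jacobian Ω ψ x).trace) = 0 := by
    have hconst : IntegrableOn (fun _ : E d => (d : ℝ) - 1) (closure Ω) :=
      integrableOn_const hcomp.measure_lt_top.ne
    have hsum : IntegrableOn (fun x => |(jacobian Ω ψ x).det| + ((d : ℝ) - 1)) (closure Ω) :=
      (hdet.integrableOn_compact hcomp).add hconst
    rw [integral_sub hsum (htr.integrableOn_compact hcomp),
      integral_add (hdet.integrableOn_compact hcomp) hconst, hvol,
      setIntegral_trace_jacobian hΩ hbdd hu hψ hfix]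
    simp
    ring
  have hcont' : ContinuousOn
      (fun x => |(jacobian Ω ψ x).det| + ((d : ℝ) - 1) - (jacobian Ω ψ x).trace) (closure Ω) :=
    (hdet.add continuousOn_const).sub htr
  have hae := (setIntegral_eq_zero_iff_of_nonneg_ae
    ((ae_restrict_iff' isClosed_closure.measurableSet).2 (Filter.Eventually.of_forall fun x hx =>
      sub_nonneg.2 (trace_le_of_conformal hd (hs x hx)).1))
    (hcont'.integrableOn_compact hcomp)).1 hint
  -- Almost everywhere becomes everywhere: the gap is continuous, and `closure Ω` is the closure of
  -- its interior.
  have hzero := Measure.eqOn_of_ae_eq hae hcont' continuousOn_const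
    (closure_mono (interior_maximal subset_closure hΩ))
  intro x hx
  exact (trace_le_of_conformal hd (hs x hx)).2 (sub_eq_zero.1 (hzero hx)).symm

/-- A map of `closure Ω` with derivative `1` that fixes the boundary is the identity. -/
theorem eq_id_of_jacobian_eq_one (hd : 0 < d) (hΩ : IsOpen Ω) (hbdd : Bornology.IsBounded Ω)
    (hψ : ContDiffOn ℝ ∞ ψ (closure Ω)) (hfix : ∀ x ∈ frontier Ω, ψ x = x)
    (hJ : ∀ x ∈ closure Ω, jacobian Ω ψ x = 1) : ∀ x ∈ closure Ω, ψ x = x := by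
  intro x hx
  by_cases hxΩ : x ∈ Ω
  · have : Nonempty (Fin d) := ⟨⟨0, hd⟩⟩
    obtain ⟨y, hy⟩ : ∃ y, y ∉ Ω := by
      by_contra! h
      rw [eq_univ_of_forall h] at hbdd
      exact NormedSpace.unbounded_univ ℝ (E d) hbdd
    ext i
    -- The displacement has derivative zero, so the distance estimate with constant `0`, against any
    -- exterior point, makes it vanish.
    have h := abs_le_mul_norm_sub_of_eqOn_frontier (L := 0) (f := fun y => (ψ y - y) i) hΩ
      (fun x hx => (hasFDerivWithinAt_displacement hψ i hx).differentiableWithinAt)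
      (fun x hx => by
        rw [(hasFDerivAt_displacement hΩ hψ i hx).fderiv,
          fderivWithin_eq_id_of_jacobian_eq_one (hJ x (subset_closure hx))]
        simp)
      (fun x hx => by simp [hfix x hx]) hxΩ hy
    rw [zero_mul, abs_nonpos_iff] at h
    exact sub_eq_zero.1 h
  · exact hfix x ⟨hx, by rwa [hΩ.interior_eq]⟩

end Rigidity

/-! ### Gauge transformations preserving the Euclidean metric -/

section Gauge

variable {d : ℕ} {Ω : Set (E d)}

/-- A nowhere vanishing function on the connected `closure Ω` that equals `1` somewhere cannot
change sign. Positivity is what allows `μ` to be recovered from its real power. -/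
theorem IsGaugeFunction.pos {μ : E d → ℝ} (hμ : IsGaugeFunction Ω μ) (hΩ : IsConnected Ω)
    (hfr : (frontier Ω).Nonempty) {x : E d} (hx : x ∈ closure Ω) : 0 < μ x := by
  by_contra! h
  obtain ⟨z, hz⟩ := hfr
  obtain ⟨y, hy, hy0⟩ := hΩ.isPreconnected.closure.intermediate_value hx
    (frontier_subset_closure hz) hμ.1.continuousOn ⟨h, by rw [hμ.2.2 z hz]; exact zero_le_one⟩
  exact hμ.2.1 y hy hy0

theorem frontier_nonempty_of_isBounded (hd : 0 < d) (hbdd : Bornology.IsBounded Ω)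
    (hne : Ω.Nonempty) : (frontier Ω).Nonempty := by
  have : Nonempty (Fin d) := ⟨⟨0, hd⟩⟩
  refine nonempty_frontier_iff.2 ⟨hne, fun h => ?_⟩
  rw [h] at hbdd
  exact NormedSpace.unbounded_univ ℝ (E d) hbdd

theorem pushMetric_euclideanMetric (φ : BoundaryFixingDiffeo Ω) (y : E d) :
    pushMetric φ (euclideanMetric d) y
      = (jacobian Ω φ.invFun y).transpose * jacobian Ω φ.invFun y := by
  ext i j
  simp [pushMetric, euclideanMetric, Matrix.mul_apply, Matrix.one_apply]

theorem BoundaryFixingDiffeo.invFun_fixes (φ : BoundaryFixingDiffeo Ω) {x : E d}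
    (hx : x ∈ frontier Ω) : φ.invFun x = x := by
  have := φ.left_inv (frontier_subset_closure hx)
  rwa [φ.fixes x hx] at this

/-- A gauge transformation that maps a Euclidean triplet to a Euclidean triplet is trivial. -/
theorem eq_id_of_gauge_euclidean (hd : d = 2 ∨ d = 3) (hΩ : IsSmoothDomain Ω)
    (hbdd : Bornology.IsBounded Ω) (hconn : IsConnected Ω) (φ : BoundaryFixingDiffeo Ω)
    {μ : E d → ℝ} (hμ : IsGaugeFunction Ω μ)
    (hg : EqOn (fun x => (μ x) ^ (-(2 : ℝ) / (2 + d)) • pushMetric φ (euclideanMetric d) x)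
      (euclideanMetric d) (closure Ω)) :
    (∀ x ∈ closure Ω, φ.toFun x = x) ∧ (∀ x ∈ closure Ω, μ x = 1) := by
  have hd0 : 0 < d := by omega
  have hu := hΩ.uniqueDiffOn_closure
  have hinvfix : ∀ x ∈ frontier Ω, φ.invFun x = x := fun x hx => φ.invFun_fixes hx
  -- Rigidity is applied to `φ.invFun`, since the pushforward of a covariant tensor involves the
  -- Jacobian of the inverse.
  have hJ := jacobian_eq_one_of_conformal hd hΩ.1 hbdd hu φ.smooth_inv φ.right_inv.injOn
    (φ.left_inv.surjOn φ.mapsTo |>.image_eq_of_mapsTo φ.mapsTo_inv) hinvfix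
    (fun x hx => by rw [← pushMetric_euclideanMetric]; exact hg hx)
  have hid := eq_id_of_jacobian_eq_one hd0 hΩ.1 hbdd φ.smooth_inv hinvfix fun x hx => (hJ x hx).1
  refine ⟨fun x hx => ?_, fun x hx => ?_⟩
  · have := φ.right_inv hx
    rwa [hid x hx] at this
  · have hpos := hμ.pos hconn (frontier_nonempty_of_isBounded hd0 hbdd hconn.nonempty) hx
    have hexp : -(2 : ℝ) / (2 + d) ≠ 0 := by
      have : (0 : ℝ) < 2 + d := by positivity
      exact div_ne_zero (by norm_num) this.ne'
    exact (Real.rpow_left_inj hpos.le zero_le_one hexp).1 ((hJ x hx).2.trans (Real.one_rpow _).symm)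

/-- The gauge transformation by the identity and the constant `1` is trivial on Euclidean
triplets. -/
theorem gauge_eqOn_of_eq_id (hu : UniqueDiffOn ℝ (closure Ω)) (φ : BoundaryFixingDiffeo Ω)
    {μ : E d → ℝ} (hφ : ∀ x ∈ closure Ω, φ.toFun x = x) (hμ : ∀ x ∈ closure Ω, μ x = 1)
    (ρ : E d → ℝ) (c : Tensor4Field d) :
    (gauge φ μ ⟨ρ, c, euclideanMetric d⟩).EqOn ⟨ρ, c, euclideanMetric d⟩ (closure Ω) := by
  have hinv : ∀ x ∈ closure Ω, φ.invFun x = x := fun x hx => by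
    have := φ.left_inv hx
    rwa [hφ x hx] at this
  refine ⟨fun x hx => ?_, fun x hx => ?_, fun x hx => ?_⟩
  · simp [gauge, pushDensity, hμ x hx, hinv x hx]
  · ext i j k l
    simp [gauge, pushStiffness, hμ x hx, hinv x hx, jacobian_eq_one_of_eqOn_id hu hφ hx,
      Matrix.one_apply]
  · simp [gauge, hμ x hx, pushMetric_euclideanMetric, jacobian_eq_one_of_eqOn_id hu hinv hx,
      euclideanMetric]

end Gauge

end ElasticGauge

/-! ### Elimination of the gauge freedoms -/

theorem mainTheorem4 {d : ℕ} (hd : d = 2 ∨ d = 3) (Ω : Set (ElasticGauge.E d))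
    (hΩ : ElasticGauge.IsSmoothDomain Ω) (hbdd : Bornology.IsBounded Ω)
    (hconn : IsConnected Ω) (hsc : IsSimplyConnected Ω)
    (ρ : ElasticGauge.E d → ℝ) (hρ : ElasticGauge.IsDensity Ω ρ)
    (c : ElasticGauge.Tensor4Field d)
    (hc : ElasticGauge.IsStiffnessTensor Ω (ElasticGauge.euclideanMetric d) c)
    (φ : ElasticGauge.BoundaryFixingDiffeo Ω)
    (μ : ElasticGauge.E d → ℝ) (hμ : ElasticGauge.IsGaugeFunction Ω μ) :
    (∀ (ρ' : ElasticGauge.E d → ℝ) (c' : ElasticGauge.Tensor4Field d),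
      (ElasticGauge.gauge φ μ ⟨ρ, c, ElasticGauge.euclideanMetric d⟩).EqOn
          ⟨ρ', c', ElasticGauge.euclideanMetric d⟩ (closure Ω) →
        (∀ x ∈ closure Ω, φ.toFun x = x) ∧ (∀ x ∈ closure Ω, μ x = 1) ∧
        (∀ x ∈ closure Ω, ρ' x = ρ x) ∧ (∀ x ∈ closure Ω, c' x = c x)) ∧
    (∀ T : ℝ, 0 < T →
      (ElasticGauge.IsEuclideanDNGauge Ω T ρ c φ μ ↔
        (∀ x ∈ closure Ω, φ.toFun x = x) ∧ (∀ x ∈ closure Ω, μ x = 1))) := by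
  have hu := hΩ.uniqueDiffOn_closure
  refine ⟨fun ρ' c' h => ?_, fun T _ => ⟨fun ⟨ρ', c', h, _⟩ => ?_, fun h => ?_⟩⟩
  · obtain ⟨hφ1, hμ1⟩ := ElasticGauge.eq_id_of_gauge_euclidean hd hΩ hbdd hconn φ hμ h.2.2
    have h' := ElasticGauge.gauge_eqOn_of_eq_id hu φ hφ1 hμ1 ρ c
    exact ⟨hφ1, hμ1, fun x hx => (h.1 hx).symm.trans (h'.1 hx),
      fun x hx => (h.2.1 hx).symm.trans (h'.2.1 hx)⟩
  · exact ElasticGauge.eq_id_of_gauge_euclidean hd hΩ hbdd hconn φ hμ h.2.2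
  -- With `ρ` and `c` themselves as witnesses the two Dirichlet-to-Neumann maps are literally the
  -- same, so no solvability of the wave equation is needed.
  · exact ⟨ρ, c, ElasticGauge.gauge_eqOn_of_eq_id hu φ h.1 h.2 ρ c, rfl⟩
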